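/- Let $K\in\{\mathbb R,\mathbb C\}$. A $K$-Banach space $X$ is regarded as a metric structure of continuous first-order logic whose universe is the closed unit ball $B(X)$ with metric $\|x-y\|$, with a constant for $0$ and, for every finite tuple $\bar a$ from $K$, a predicate $s_{\bar a}(\bar x)=\|\sum_i a_ix_i\|$ and a function $\sigma_{\bar a}(\bar x)$, equal to $\sum_i a_ix_i$ if this vector has norm at most $1$ and to $\sum_i a_ix_i/\|\sum_i a_ix_i\|$ otherwise. $\mathrm{Th}(\ell_p)$ is the set of all closed conditions $\varphi=0$ ($\varphi$ a sentence) that hold in $\ell_p=\ell_p(\mathbb N;K)$. For $n$-tuples of vectors write $\bar b\cong\bar c$ (congruent) if $\|b_i-b_j\|=\|c_i-c_j\|$ and $\|b_i\|=\|c_i\|$ for all $i,j$. For $A\subseteq B(X)$, a real linear subspace $V\subseteq X$ is an indiscernible subspace over $A$ if for every $n$ and all $n$-tuples $\bar b,\bar c$ of elements of $V\cap B(X)$, $\bar b$ and $\bar c$ have the same type over $A$ if and only if $\bar b\cong\bar c$. The partial type (over $\varnothing$) of an infinite-dimensional indiscernible subspace, in variables $(x_i)_{i<\omega}$ standing for an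 orthonormal sequence that spans it, consists of the conditions $$\Big\|\sum_{i<m}a_ix_i\Big\|=\Big(\sum_{i<m}a_i^2\Big)^{1/2}\qquad(m<\omega,\ \bar a\in\mathbb R^m)$$ and $$\varphi\Big(\sum_{j<m}b_{1j}x_j,\dots,\sum_{j<m}b_{nj}x_j\Big)=\varphi\Big(\sum_{j<m}c_{1j}x_j,\dots,\sum_{j<m}c_{nj}x_j\Big)$$ for all $n,m<\omega$, all formulas $\varphi$ in $n$ free variables, and all congruent $n$-tuples $\bar b,\bar c$ of vectors in the closed unit ball of Euclidean $\mathbb R^m$ (the sums being formed with the functions $\sigma$). **Theorem.** Let $p\in[1,\infty)\setminus\{2\}$. For every cardinal $\kappa$ there is a $K$-Banach space $X$ such that the structure $B(X)$ is a model of $\mathrm{Th}(\ell_p)$ of density character at least $\kappa$, and: 1. no infinite-dimensional real linear subspace of $X$ is isomorphic (linearly homeomorphic) to a real Hilbert space; 2. for every $A\subseteq B(X)$, every indiscernible subspace of $X$ over $A$ is finite-dimensional; 3. $X$ omits the partial type of an infinite-dimensional indiscernible subspace: no sequence in $B(X)$ realizes it. -/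

import Mathlib

universe u v w

noncomputable section

namespace ContinuousLogic

/-! ### Continuous first-order logic -/

/-- A signature for metric structures (one sort): function and predicate symbols, each with a
modulus of uniform continuity, a bound for the values of each predicate symbol, and a bound for the
diameter. -/
structure Signature extends FirstOrder.Language.{u, v} where
  diamBound : ℝ
  funModulus : ∀ {n : ℕ}, Functions n → ℝ → ℝ
  funModulus_pos : ∀ {n : ℕ} (f : Functions n) (ε : ℝ), 0 < ε → 0 < funModulus f ε
  predBound : ∀ {n : ℕ}, Relations n → ℝ
  predModulus : ∀ {n : ℕ}, Relations n → ℝ → ℝ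
  predModulus_pos : ∀ {n : ℕ} (P : Relations n) (ε : ℝ), 0 < ε → 0 < predModulus P ε

/-- Terms with variables in `α` (Mathlib's first-order terms). -/
abbrev Signature.Term (L : Signature.{u, v}) (α : Type w) := L.toLanguage.Term α

/-- A metric `L`-structure with underlying metric space `M`: a nonempty complete bounded metric
space with uniformly continuous functions and bounded uniformly continuous real-valued predicates,
obeying the moduli and bounds which the signature prescribes. -/
structure MetricStructure (L : Signature.{u, v}) (M : Type w) [MetricSpace M] where
  nonempty : Nonempty M
  complete : CompleteSpace M
  dist_le : ∀ x y : M, dist x y ≤ L.diamBound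
  func : ∀ {n : ℕ}, L.Functions n → (Fin n → M) → M
  pred : ∀ {n : ℕ}, L.Relations n → (Fin n → M) → ℝ
  func_modulus : ∀ {n : ℕ} (f : L.Functions n) (ε : ℝ), 0 < ε → ∀ x y : Fin n → M,
    (∀ i, dist (x i) (y i) < L.funModulus f ε) → dist (func f x) (func f y) ≤ ε
  pred_bound : ∀ {n : ℕ} (P : L.Relations n) (x : Fin n → M), |pred P x| ≤ L.predBound P
  pred_modulus : ∀ {n : ℕ} (P : L.Relations n) (ε : ℝ), 0 < ε → ∀ x y : Fin n → M,
    (∀ i, dist (x i) (y i) < L.predModulus P ε) → |pred P x - pred P y| ≤ ε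

/-- Formulas of continuous logic with free variables indexed by `α` and by `Fin n` (the latter are
the ones that quantifiers bind, the last one first). Atomic formulas are distances of terms and
predicates of terms, connectives are all continuous functions `ℝ^k → ℝ`, and the quantifiers are
`sup` and `inf`. -/
inductive Formula (L : Signature.{u, v}) (α : Type w) : ℕ → Type (max u v w)
  | dist {n : ℕ} (s t : L.Term (α ⊕ Fin n)) : Formula L α n
  | pred {n k : ℕ} (P : L.Relations k) (t : Fin k → L.Term (α ⊕ Fin n)) : Formula L α n
  | conn {n k : ℕ} (c : C(Fin k → ℝ, ℝ)) (φ : Fin k → Formula L α n) : Formula L α n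
  | sup {n : ℕ} (φ : Formula L α (n + 1)) : Formula L α n
  | inf {n : ℕ} (φ : Formula L α (n + 1)) : Formula L α n

/-- A sentence is a formula without free variables. -/
abbrev Sentence (L : Signature.{u, v}) := Formula L Empty 0

namespace Formula

variable {L : Signature.{u, v}} {α β : Type w}

/-- Substitution of terms for the free variables in `α`. -/
def subst (f : α → L.Term β) : ∀ {n : ℕ}, Formula L α n → Formula L β n
  | n, .dist s t => .dist (s.subst (substVar n)) (t.subst (substVar n))
  | n, .pred P t => .pred P (fun i => (t i).subst (substVar n))
  | _, .conn c φ => .conn c (fun i => (φ i).subst f)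
  | _, .sup φ => .sup (φ.subst f)
  | _, .inf φ => .inf (φ.subst f)
where
  substVar (n : ℕ) : α ⊕ Fin n → L.Term (β ⊕ Fin n) :=
    Sum.elim (fun a => (f a).relabel Sum.inl) (fun i => .var (Sum.inr i))

/-- The constant formula `r`. -/
def const (r : ℝ) {n : ℕ} : Formula L α n :=
  .conn (k := 0) (ContinuousMap.const _ r) Fin.elim0

/-- The formula `|φ - ψ|`. -/
def absDiff {n : ℕ} (φ ψ : Formula L α n) : Formula L α n :=
  .conn (k := 2) ⟨fun x => |x 0 - x 1|, by fun_prop⟩ ![φ, ψ]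

end Formula

namespace MetricStructure

variable {L : Signature.{u, v}} {M : Type w} [MetricSpace M] (S : MetricStructure L M)

/-- The value of a term under an assignment of the variables. -/
def termValue {α : Type*} (x : α → M) : L.Term α → M
  | .var a => x a
  | .func f t => S.func f (fun i => termValue x (t i))

/-- The value of a formula under an assignment of the variables. -/
def eval {α : Type*} (x : α → M) : ∀ {n : ℕ}, Formula L α n → (Fin n → M) → ℝ
  | _, .dist s t, y => Dist.dist (S.termValue (Sum.elim x y) s) (S.termValue (Sum.elim x y) t)
  | _, .pred P t, y => S.pred P (fun i => S.termValue (Sum.elim x y) (t i))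
  | _, .conn c φ, y => c (fun i => eval x (φ i) y)
  | _, .sup φ, y => ⨆ z : M, eval x φ (Fin.snoc y z)
  | _, .inf φ, y => ⨅ z : M, eval x φ (Fin.snoc y z)

/-- The value of a formula all of whose free variables are in `α`. -/
def value {α : Type*} (x : α → M) (φ : Formula L α 0) : ℝ := S.eval x φ Fin.elim0

/-- `S` satisfies all the conditions `φ = 0`, for `φ ∈ T`. -/
def Models (T : Set (Sentence L)) : Prop := ∀ φ ∈ T, S.value Empty.elim φ = 0

/-- The theory of `S`, the set of all closed conditions `φ = 0` that hold in `S`. -/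
def theory : Set (Sentence L) := {φ | S.value Empty.elim φ = 0}

/-- The assignment `x` realizes the partial type that consists of the conditions `φ = 0`,
`φ ∈ p`. -/
def Realizes {α : Type*} (x : α → M) (p : Set (Formula L α 0)) : Prop :=
  ∀ φ ∈ p, S.value x φ = 0

/-- The partial type `p` (without parameters) is omitted in `S`. -/
def Omits {α : Type*} (p : Set (Formula L α 0)) : Prop := ∀ x : α → M, ¬ S.Realizes x p

/-- `b ≡_A c`: the tuples `b` and `c` have the same type over `A`, that is, they give the same
value to every formula with parameters from `A`. -/
def SameTypeOver (A : Set M) {n : ℕ} (b c : Fin n → M) : Prop :=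
  ∀ φ : Formula L (A ⊕ Fin n) 0,
    S.value (Sum.elim Subtype.val b) φ = S.value (Sum.elim Subtype.val c) φ

end MetricStructure

/-- The density character of a topological space. -/
def densityCharacter (M : Type w) [TopologicalSpace M] : Cardinal.{w} :=
  sInf {c | ∃ s : Set M, Dense s ∧ Cardinal.mk s = c}

/-! ### Banach spaces as metric structures -/

/-- The function symbols: the constant `0` and the symbols `σ_a` for tuples `a` of scalars. -/
inductive BanachFunc (K : Type u) : ℕ → Type u
  | zero : BanachFunc K 0
  | lin {n : ℕ} (a : Fin n → K) : BanachFunc K n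

/-- The predicate symbols `s_a` for tuples `a` of scalars. -/
inductive BanachPred (K : Type u) : ℕ → Type u
  | norm {n : ℕ} (a : Fin n → K) : BanachPred K n

/-- The signature of `K`-Banach spaces. -/
def banachSignature (K : Type u) [RCLike K] : Signature.{u, u} where
  Functions := BanachFunc K
  Relations := BanachPred K
  diamBound := 2
  funModulus := fun f ε => match f with
    | .zero => ε
    | .lin a => ε / (2 * (∑ i, ‖a i‖ + 1))
  funModulus_pos := by
    intro n f ε hε
    cases f with
    | zero => exact hε
    | lin a =>
      have : 0 ≤ ∑ i, ‖a i‖ := Finset.sum_nonneg fun i _ => norm_nonneg _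
      exact div_pos hε (by linarith)
  predBound := fun P => match P with
    | .norm a => ∑ i, ‖a i‖
  predModulus := fun P ε => match P with
    | .norm a => ε / (∑ i, ‖a i‖ + 1)
  predModulus_pos := by
    intro n P ε hε
    cases P with
    | norm a =>
      have : 0 ≤ ∑ i, ‖a i‖ := Finset.sum_nonneg fun i _ => norm_nonneg _
      exact div_pos hε (by linarith)

section

variable (K : Type u) [RCLike K] {X : Type w} [NormedAddCommGroup X] [NormedSpace K X]

/-- A vector, divided by its norm if it is outside the closed unit ball. -/
def toBall (x : X) : X := if ‖x‖ ≤ 1 then x else ((‖x‖⁻¹ : ℝ) : K) • x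

theorem norm_toBall_le (x : X) : ‖toBall K x‖ ≤ 1 := by
  unfold toBall
  split_ifs with h
  · exact h
  · have hx : 0 < ‖x‖ := by linarith
    rw [norm_smul, RCLike.norm_ofReal, abs_of_pos (inv_pos.2 hx), inv_mul_cancel₀ hx.ne']

theorem norm_sub_smul_inv_norm (x : X) (h : 1 < ‖x‖) :
    ‖((‖x‖⁻¹ : ℝ) : K) • x - x‖ = ‖x‖ - 1 := by
  have hx : 0 < ‖x‖ := by linarith
  have h1 : ((‖x‖⁻¹ : ℝ) : K) • x - x = ((‖x‖⁻¹ - 1 : ℝ) : K) • x := by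
    rw [RCLike.ofReal_sub, sub_smul, RCLike.ofReal_one, one_smul]
  have h2 : ‖x‖⁻¹ - 1 ≤ 0 := by
    have := inv_le_one_of_one_le₀ h.le
    linarith
  rw [h1, norm_smul, RCLike.norm_ofReal, abs_of_nonpos h2]
  field_simp
  ring

theorem norm_toBall_sub_le (x y : X) : ‖toBall K x - toBall K y‖ ≤ 2 * ‖x - y‖ := by
  have key : ∀ x y : X, 1 < ‖x‖ → ‖y‖ ≤ 1 →
      ‖((‖x‖⁻¹ : ℝ) : K) • x - y‖ ≤ 2 * ‖x - y‖ := by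
    intro x y hx hy
    have h1 := norm_sub_norm_le x y
    have h2 := norm_add_le (((‖x‖⁻¹ : ℝ) : K) • x - x) (x - y)
    rw [sub_add_sub_cancel, norm_sub_smul_inv_norm K x hx] at h2
    linarith
  unfold toBall
  split_ifs with hx hy hy
  · linarith [norm_nonneg (x - y)]
  · rw [norm_sub_rev, norm_sub_rev x y]
    exact key y x (not_le.1 hy) hx
  · exact key x y (not_le.1 hx) hy
  · push Not at hx hy
    have hx0 : 0 < ‖x‖ := by linarith
    have hy0 : 0 < ‖y‖ := by linarith
    have e : ((‖x‖⁻¹ : ℝ) : K) • x - ((‖y‖⁻¹ : ℝ) : K) • y =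
        ((‖x‖⁻¹ : ℝ) : K) • (x - y) + ((‖x‖⁻¹ - ‖y‖⁻¹ : ℝ) : K) • y := by
      rw [RCLike.ofReal_sub, sub_smul, smul_sub]
      abel
    have h3 : |‖x‖⁻¹ - ‖y‖⁻¹| * ‖y‖ = ‖x‖⁻¹ * |‖y‖ - ‖x‖| := by
      rw [← abs_of_pos hy0, ← abs_mul, abs_of_pos hy0, ← abs_of_pos (inv_pos.2 hx0), ← abs_mul,
        abs_of_pos (inv_pos.2 hx0)]
      congr 1
      field_simp
    have h4 : |‖y‖ - ‖x‖| ≤ ‖x - y‖ := by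
      rw [norm_sub_rev]; exact abs_norm_sub_norm_le y x
    have h5 : ‖x‖⁻¹ ≤ 1 := inv_le_one_of_one_le₀ hx.le
    calc _ ≤ ‖x‖⁻¹ * ‖x - y‖ + |‖x‖⁻¹ - ‖y‖⁻¹| * ‖y‖ := by
            rw [e]
            refine (norm_add_le _ _).trans_eq ?_
            rw [norm_smul, norm_smul, RCLike.norm_ofReal, RCLike.norm_ofReal,
              abs_of_pos (inv_pos.2 hx0)]
      _ ≤ 1 * ‖x - y‖ + 1 * ‖x - y‖ := by
            rw [h3]
            gcongr
      _ = 2 * ‖x - y‖ := by ring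

theorem norm_lin_sub_le {n : ℕ} (a : Fin n → K) (x y : Fin n → X) (δ : ℝ) (hδ : 0 ≤ δ)
    (h : ∀ i, dist (x i) (y i) < δ) :
    ‖∑ i, a i • x i - ∑ i, a i • y i‖ ≤ (∑ i, ‖a i‖ + 1) * δ := by
  rw [← Finset.sum_sub_distrib]
  refine (norm_sum_le _ _).trans ?_
  have : ∑ i, ‖a i • x i - a i • y i‖ ≤ (∑ i, ‖a i‖) * δ := by
    rw [Finset.sum_mul]
    refine Finset.sum_le_sum fun i _ => ?_
    rw [← smul_sub, norm_smul]
    exact mul_le_mul_of_nonneg_left (by simpa [dist_eq_norm] using (h i).le) (norm_nonneg _)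
  linarith

/-- The closed unit ball of `X`. -/
abbrev UnitBall (X : Type w) [NormedAddCommGroup X] := Metric.closedBall (0 : X) 1

variable (X)

/-- The Banach space `X` as a metric structure: its universe is the closed unit ball, with
`s_a(x) = ‖∑ aᵢ xᵢ‖`, and with `σ_a(x) = ∑ aᵢ xᵢ`, divided by its norm if that is greater
than `1`. -/
def banachStructure [CompleteSpace X] :
    MetricStructure (banachSignature K) (UnitBall X) where
  nonempty := ⟨⟨0, by simp⟩⟩
  complete := Metric.isClosed_closedBall.completeSpace_coe
  dist_le := by
    intro x y
    have hx := mem_closedBall_zero_iff.1 x.2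
    have hy := mem_closedBall_zero_iff.1 y.2
    have := norm_sub_le (x : X) y
    rw [Subtype.dist_eq, dist_eq_norm]
    change _ ≤ (2 : ℝ)
    linarith
  func := fun f x => match f with
    | .zero => ⟨0, by simp⟩
    | .lin a => ⟨toBall K (∑ i, a i • (x i : X)), by simpa using norm_toBall_le K _⟩
  pred := fun P x => match P with
    | .norm a => ‖∑ i, a i • (x i : X)‖
  func_modulus := by
    intro n f ε hε x y h
    cases f with
    | zero => simpa using hε.le
    | lin a =>
      have hs : 0 ≤ ∑ i, ‖a i‖ := Finset.sum_nonneg fun i _ => norm_nonneg _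
      have h' := norm_lin_sub_le K a (fun i => (x i : X)) (fun i => (y i : X))
        (ε / (2 * (∑ i, ‖a i‖ + 1))) (by positivity) h
      have h2 := norm_toBall_sub_le K (∑ i, a i • (x i : X)) (∑ i, a i • (y i : X))
      have h3 : (∑ i, ‖a i‖ + 1) * (ε / (2 * (∑ i, ‖a i‖ + 1))) = ε / 2 := by
        field_simp
      rw [Subtype.dist_eq, dist_eq_norm]
      change ‖toBall K (∑ i, a i • (x i : X)) - toBall K (∑ i, a i • (y i : X))‖ ≤ ε
      linarith
  pred_bound := by
    intro n P x
    cases P with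
    | norm a =>
      change |‖∑ i, a i • (x i : X)‖| ≤ ∑ i, ‖a i‖
      rw [abs_norm]
      refine (norm_sum_le _ _).trans (Finset.sum_le_sum fun i _ => ?_)
      rw [norm_smul]
      exact mul_le_of_le_one_right (norm_nonneg _) (mem_closedBall_zero_iff.1 (x i).2)
  pred_modulus := by
    intro n P ε hε x y h
    cases P with
    | norm a =>
      have hs : 0 ≤ ∑ i, ‖a i‖ := Finset.sum_nonneg fun i _ => norm_nonneg _
      have h' := norm_lin_sub_le K a (fun i => (x i : X)) (fun i => (y i : X))
        (ε / (∑ i, ‖a i‖ + 1)) (by positivity) h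
      have h3 : (∑ i, ‖a i‖ + 1) * (ε / (∑ i, ‖a i‖ + 1)) = ε := by
        field_simp
      have h4 := abs_norm_sub_norm_le (∑ i, a i • (x i : X)) (∑ i, a i • (y i : X))
      change |‖∑ i, a i • (x i : X)‖ - ‖∑ i, a i • (y i : X)‖| ≤ ε
      linarith

end

/-- Congruence of tuples: `‖bᵢ - bⱼ‖ = ‖cᵢ - cⱼ‖` for all `i`, `j`, where the tuples are prolonged
by the zero vector. -/
def Congruent {E F : Type*} [NormedAddCommGroup E] [NormedAddCommGroup F] {n : ℕ}
    (b : Fin n → E) (c : Fin n → F) : Prop :=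
  (∀ i j, ‖b i - b j‖ = ‖c i - c j‖) ∧ ∀ i, ‖b i‖ = ‖c i‖

/-- The real subspace `V` of the `K`-Banach space `X` is an indiscernible subspace over `A`. -/
def IsIndiscernibleSubspace (K : Type u) [RCLike K] {X : Type w} [NormedAddCommGroup X]
    [NormedSpace K X] [CompleteSpace X] [NormedSpace ℝ X]
    (A : Set (UnitBall X)) (V : Submodule ℝ X) : Prop :=
  ∀ (n : ℕ) (b c : Fin n → UnitBall X), (∀ i, (b i : X) ∈ V) → (∀ i, (c i : X) ∈ V) →
    ((banachStructure K X).SameTypeOver A b c ↔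
      Congruent (fun i => (b i : X)) (fun i => (c i : X)))

/-- The term `σ_a(x₀, …, x_{m-1})`, for a tuple `a` of real numbers. -/
def combTerm (K : Type u) [RCLike K] {m : ℕ} (a : Fin m → ℝ) : (banachSignature K).Term ℕ :=
  .func (BanachFunc.lin (fun i => (a i : K)) : BanachFunc K m) (fun i => .var (i : ℕ))

/-- The formula `‖a₀ x₀ + ⋯ + a_{m-1} x_{m-1}‖`, for a tuple `a` of real numbers. -/
def combNorm (K : Type u) [RCLike K] {m : ℕ} (a : Fin m → ℝ) :
    Formula (banachSignature K) ℕ 0 :=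
  .pred (BanachPred.norm (fun i => (a i : K)) : BanachPred K m)
    (fun i => .var (Sum.inl (i : ℕ)))

/-- The partial type (without parameters) of an infinite-dimensional indiscernible subspace, in the
variables `x₀, x₁, …`, which stand for an orthonormal sequence that spans the subspace. It says that
`‖∑ aᵢ xᵢ‖² = ∑ aᵢ²` for all real `a`, and that `φ(∑ᵢ b₁ᵢ xᵢ, …, ∑ᵢ bₙᵢ xᵢ)` and
`φ(∑ᵢ c₁ᵢ xᵢ, …, ∑ᵢ cₙᵢ xᵢ)` are equal for every formula `φ` and any two congruent tuples `b`, `c` of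
vectors in the unit ball of a Euclidean space. -/
def indiscernibleType (K : Type u) [RCLike K] : Set (Formula (banachSignature K) ℕ 0) :=
  {ψ | ∃ (m : ℕ) (a : Fin m → ℝ),
    ψ = (combNorm K a).absDiff (.const (Real.sqrt (∑ i, a i ^ 2)))} ∪
  {ψ | ∃ (n m : ℕ) (φ : Formula (banachSignature K) (Fin n) 0)
      (b c : Fin n → EuclideanSpace ℝ (Fin m)),
    (∀ i, ‖b i‖ ≤ 1) ∧ (∀ i, ‖c i‖ ≤ 1) ∧ Congruent b c ∧
    ψ = (φ.subst fun i => combTerm K fun j => b i j).absDiff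
      (φ.subst fun i => combTerm K fun j => c i j)}

end ContinuousLogic

end

noncomputable section

namespace ContinuousLogic

/-! ### Uniform continuity and boundedness of formulas -/

/-! The space is `ℓ_p(I)` with `I` the disjoint union of `κ` and `ℕ`. Permutations of the
coordinates act as automorphisms. They can fix finitely many coordinates of `ℕ` and move finitely
many others into `ℕ`, and finitely supported vectors are dense because `p < ∞`. So the Tarski–Vaught
test holds for `ℓ_p(ℕ) ⊆ ℓ_p(I)` (`eval_ballMap_extendZero`), and the theory of `ℓ_p` is preserved.

The omission results rest on a sliding hump. An infinite-dimensional subspace contains, for each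
finite `F ⊆ I`, a unit vector `g_F` vanishing on `F` (`exists_unit_vanishing`), and `‖f + g_F‖^p →
‖f‖^p + 1` for fixed `f` (`tendsto_norm_add`).

Hilbert subspaces: choosing each new hump with image orthogonal to what has been built yields `x`
with `‖x‖^p ≈ k` and `‖Tx‖² ≈ k`. An isomorphism would make `k^(2/p)` comparable to `k`, so `p = 2`
(`not_bounds_of_not_finiteDimensional`).

Indiscernible subspaces: `(x, y)` and `(y, x)` are congruent when `‖x‖ = ‖y‖`, so `‖x - ty‖ = ‖tx -
y‖`. Ficken's theorem would make such a norm Euclidean, but one limit over humps suffices: it forces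
`2^(1/p) = √2` (`finiteDimensional_of_norm_sub_smul_symm`). A realization of the type spans an
infinite-dimensional space with the same symmetry, already by its norm conditions. -/

theorem exists_pos_forall_le {ι : Type*} [Finite ι] (δ : ι → ℝ) (h : ∀ i, 0 < δ i) :
    ∃ d > 0, ∀ i, d ≤ δ i := by
  obtain ⟨d, hd⟩ := Finite.exists_ge (fun i => (⟨δ i, h i⟩ : Set.Ioi (0 : ℝ)))
  exact ⟨d.1, d.2, fun i => hd i⟩

theorem abs_iSup_sub_iSup_le {ι : Type*} [Nonempty ι] {f g : ι → ℝ} {ε : ℝ}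
    (hf : BddAbove (Set.range f)) (hg : BddAbove (Set.range g)) (h : ∀ i, |f i - g i| ≤ ε) :
    |(⨆ i, f i) - ⨆ i, g i| ≤ ε := by
  rw [abs_sub_le_iff, sub_le_iff_le_add, sub_le_iff_le_add]
  constructor
  · exact ciSup_le fun i => by linarith [le_ciSup hg i, (abs_sub_le_iff.1 (h i)).1]
  · exact ciSup_le fun i => by linarith [le_ciSup hf i, (abs_sub_le_iff.1 (h i)).2]

theorem abs_iInf_sub_iInf_le {ι : Type*} [Nonempty ι] {f g : ι → ℝ} {ε : ℝ}
    (hf : BddBelow (Set.range f)) (hg : BddBelow (Set.range g)) (h : ∀ i, |f i - g i| ≤ ε) :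
    |(⨅ i, f i) - ⨅ i, g i| ≤ ε := by
  rw [abs_sub_le_iff]
  constructor
  · have : (⨅ i, f i) - ε ≤ ⨅ i, g i :=
      le_ciInf fun i => by linarith [ciInf_le hf i, (abs_sub_le_iff.1 (h i)).1]
    linarith
  · have : (⨅ i, g i) - ε ≤ ⨅ i, f i :=
      le_ciInf fun i => by linarith [ciInf_le hg i, (abs_sub_le_iff.1 (h i)).2]
    linarith

theorem bddAbove_range_of_abs_le {ι : Type*} {f : ι → ℝ} {B : ℝ} (h : ∀ i, |f i| ≤ B) :
    BddAbove (Set.range f) :=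
  ⟨B, by rintro _ ⟨i, rfl⟩; exact (abs_le.1 (h i)).2⟩

theorem bddBelow_range_of_abs_le {ι : Type*} {f : ι → ℝ} {B : ℝ} (h : ∀ i, |f i| ≤ B) :
    BddBelow (Set.range f) :=
  ⟨-B, by rintro _ ⟨i, rfl⟩; exact (abs_le.1 (h i)).1⟩

theorem snoc_comp {M N : Type*} {n : ℕ} (f : M → N) (y : Fin n → M) (z : M) :
    (Fin.snoc (f ∘ y) (f z) : Fin (n + 1) → N) = f ∘ (Fin.snoc y z : Fin (n + 1) → M) := by
  funext i
  refine Fin.lastCases ?_ (fun i => ?_) i <;> simp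

namespace MetricStructure

variable {L : Signature.{u, v}} {M : Type*} [MetricSpace M] (S : MetricStructure L M)

/-- A bound uniform in the assignment is what makes the real `⨆` and `⨅` genuine suprema and infima,
and it confines the arguments of a connective to a compact cube. -/
theorem exists_abs_eval_le {α : Type w} {n : ℕ} (φ : Formula L α n) :
    ∃ B, ∀ (x : α → M) (y : Fin n → M), |S.eval x φ y| ≤ B := by
  have := S.nonempty
  induction φ with
  | dist s t => exact ⟨L.diamBound, fun x y => by
      rw [eval, abs_of_nonneg dist_nonneg]; exact S.dist_le _ _⟩
  | pred P t => exact ⟨L.predBound P, fun x y => S.pred_bound _ _⟩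
  | conn c φ ih =>
    choose B hB using ih
    obtain ⟨R, hR⟩ := Finite.exists_le B
    obtain ⟨C, hC⟩ := ((isCompact_univ_pi fun _ : Fin _ => isCompact_Icc (a := -R) (b := R)
      ).image c.continuous).isBounded.exists_norm_le
    refine ⟨C, fun x y => hC _ ⟨_, fun i _ => ?_, rfl⟩⟩
    exact abs_le.1 ((hB i x y).trans (hR i))
  | sup φ ih =>
    obtain ⟨B, hB⟩ := ih
    refine ⟨B, fun x y => abs_le.2 ⟨?_, ciSup_le fun z => (abs_le.1 (hB _ _)).2⟩⟩
    exact (abs_le.1 (hB x (Fin.snoc y (Classical.arbitrary M)))).1.trans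
      (le_ciSup (bddAbove_range_of_abs_le fun z => hB x (Fin.snoc y z)) _)
  | inf φ ih =>
    obtain ⟨B, hB⟩ := ih
    refine ⟨B, fun x y => abs_le.2 ⟨le_ciInf fun z => (abs_le.1 (hB _ _)).1, ?_⟩⟩
    exact (ciInf_le (bddBelow_range_of_abs_le fun z => hB x (Fin.snoc y z)) _).trans
      (abs_le.1 (hB x (Fin.snoc y (Classical.arbitrary M)))).2

theorem termValue_uniformContinuous {α : Type*} (t : L.Term α) {ε : ℝ} (hε : 0 < ε) :
    ∃ δ > 0, ∀ x x' : α → M, (∀ a, Dist.dist (x a) (x' a) < δ) →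
      Dist.dist (S.termValue x t) (S.termValue x' t) < ε := by
  induction t generalizing ε with
  | var a => exact ⟨ε, hε, fun x x' h => h a⟩
  | func f t ih =>
    choose δ hδ h using fun i => ih i (L.funModulus_pos f (ε / 2) (half_pos hε))
    obtain ⟨d, hd, hle⟩ := exists_pos_forall_le δ hδ
    refine ⟨d, hd, fun x x' hx => ?_⟩
    refine (S.func_modulus f (ε / 2) (half_pos hε) _ _ fun i => ?_).trans_lt (half_lt_self hε)
    exact h i x x' fun a => (hx a).trans_le (hle i)

/-- Induction on the formula. Connectives are uniformly continuous on the compact cube that contains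
the values of their arguments; quantifiers inherit the modulus because it does not depend on the
assignment. -/
theorem eval_uniformContinuous {α : Type w} {n : ℕ} (φ : Formula L α n) {ε : ℝ} (hε : 0 < ε) :
    ∃ δ > 0, ∀ (x x' : α → M) (y y' : Fin n → M), (∀ a, Dist.dist (x a) (x' a) < δ) →
      (∀ i, Dist.dist (y i) (y' i) < δ) → |S.eval x φ y - S.eval x' φ y'| ≤ ε := by
  have := S.nonempty
  induction φ generalizing ε with
  | dist s t =>
    obtain ⟨δ, hδ, h⟩ := S.termValue_uniformContinuous s (half_pos hε)
    obtain ⟨δ', hδ', h'⟩ := S.termValue_uniformContinuous t (half_pos hε)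
    refine ⟨min δ δ', lt_min hδ hδ', fun x x' y y' hx hy => ?_⟩
    have h1 := h (Sum.elim x y) (Sum.elim x' y') (by
      rintro (a | i)
      exacts [(hx a).trans_le (min_le_left _ _), (hy i).trans_le (min_le_left _ _)])
    have h2 := h' (Sum.elim x y) (Sum.elim x' y') (by
      rintro (a | i)
      exacts [(hx a).trans_le (min_le_right _ _), (hy i).trans_le (min_le_right _ _)])
    have h3 := dist_dist_dist_le (S.termValue (Sum.elim x y) s) (S.termValue (Sum.elim x y) t)
      (S.termValue (Sum.elim x' y') s) (S.termValue (Sum.elim x' y') t)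
    rw [Real.dist_eq] at h3
    exact h3.trans (by linarith)
  | pred P t =>
    choose δ hδ h using fun i =>
      S.termValue_uniformContinuous (t i) (L.predModulus_pos P ε hε)
    obtain ⟨d, hd, hle⟩ := exists_pos_forall_le δ hδ
    refine ⟨d, hd, fun x x' y y' hx hy => S.pred_modulus P ε hε _ _ fun i => h i _ _ ?_⟩
    rintro (a | i')
    exacts [(hx a).trans_le (hle i), (hy i').trans_le (hle i)]
  | conn c φ ih =>
    choose B hB using fun i => S.exists_abs_eval_le (φ i)
    obtain ⟨R, hR⟩ := Finite.exists_le B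
    have huc := (isCompact_univ_pi fun _ : Fin _ => isCompact_Icc (a := -R) (b := R)
      ).uniformContinuousOn_of_continuous c.continuous.continuousOn
    obtain ⟨η, hη, hc⟩ := Metric.uniformContinuousOn_iff.1 huc ε hε
    choose δ hδ h using fun i => ih i (half_pos hη)
    obtain ⟨d, hd, hle⟩ := exists_pos_forall_le δ hδ
    refine ⟨d, hd, fun x x' y y' hx hy => ?_⟩
    have := hc (fun i => S.eval x (φ i) y) (fun i _ => abs_le.1 ((hB i x y).trans (hR i)))
      (fun i => S.eval x' (φ i) y') (fun i _ => abs_le.1 ((hB i x' y').trans (hR i))) (by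
        rw [dist_pi_lt_iff hη]
        intro i
        refine (h i x x' y y' (fun a => (hx a).trans_le (hle i))
          fun j => (hy j).trans_le (hle i)).trans_lt (half_lt_self hη))
    exact this.le
  | sup φ ih =>
    obtain ⟨δ, hδ, h⟩ := ih hε
    obtain ⟨B, hB⟩ := S.exists_abs_eval_le φ
    refine ⟨δ, hδ, fun x x' y y' hx hy => abs_iSup_sub_iSup_le
      (bddAbove_range_of_abs_le fun z => hB x (Fin.snoc y z))
      (bddAbove_range_of_abs_le fun z => hB x' (Fin.snoc y' z)) fun z => h _ _ _ _ hx ?_⟩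
    intro i
    refine Fin.lastCases ?_ (fun i => ?_) i
    · simpa using hδ
    · simpa using hy i
  | inf φ ih =>
    obtain ⟨δ, hδ, h⟩ := ih hε
    obtain ⟨B, hB⟩ := S.exists_abs_eval_le φ
    refine ⟨δ, hδ, fun x x' y y' hx hy => abs_iInf_sub_iInf_le
      (bddBelow_range_of_abs_le fun z => hB x (Fin.snoc y z))
      (bddBelow_range_of_abs_le fun z => hB x' (Fin.snoc y' z)) fun z => h _ _ _ _ hx ?_⟩
    intro i
    refine Fin.lastCases ?_ (fun i => ?_) i
    · simpa using hδ
    · simpa using hy i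

/-! ### Embeddings and the Tarski–Vaught test -/

variable {S} {N : Type*} [MetricSpace N] {S' : MetricStructure L N}

/-- A map that preserves distances, functions and predicates. -/
structure IsEmbedding (S : MetricStructure L M) (S' : MetricStructure L N) (f : M → N) :
    Prop where
  isometry : Isometry f
  map_func : ∀ {n : ℕ} (F : L.Functions n) (x : Fin n → M), f (S.func F x) = S'.func F (f ∘ x)
  map_pred : ∀ {n : ℕ} (P : L.Relations n) (x : Fin n → M), S'.pred P (f ∘ x) = S.pred P x

theorem IsEmbedding.termValue {f : M → N} (hf : IsEmbedding S S' f) {α : Type*} (x : α → M)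
    (t : L.Term α) : S'.termValue (f ∘ x) t = f (S.termValue x t) := by
  induction t with
  | var a => rfl
  | func F t ih =>
    rw [MetricStructure.termValue, MetricStructure.termValue, hf.map_func]
    congr 1
    exact funext ih

/-- An embedding preserves a formula of the form `sup φ` or `inf φ` if it preserves `φ` and meets
the condition of the Tarski–Vaught test. -/
theorem IsEmbedding.eval_of_test {f : M → N} (hf : IsEmbedding S S' f) {α : Type w} {n : ℕ}
    (htest : ∀ {n : ℕ} (φ : Formula L α (n + 1)) (x : α → M) (y : Fin n → M) (w : N),
      ∀ ε > 0, ∃ z : M, |S'.eval (f ∘ x) φ (Fin.snoc (f ∘ y) (f z)) -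
        S'.eval (f ∘ x) φ (Fin.snoc (f ∘ y) w)| ≤ ε)
    (φ : Formula L α n) (x : α → M) (y : Fin n → M) :
    S'.eval (f ∘ x) φ (f ∘ y) = S.eval x φ y := by
  have := S.nonempty
  have := S'.nonempty
  induction φ with
  | dist s t =>
    rw [eval, eval, ← Sum.comp_elim, hf.termValue, hf.termValue, hf.isometry.dist_eq]
  | pred P t =>
    rw [eval, eval, ← Sum.comp_elim, ← hf.map_pred]
    simp only [hf.termValue]
    rfl
  | conn c φ ih =>
    rw [eval, eval]
    simp only [ih]
  | sup φ ih =>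
    obtain ⟨B, hB⟩ := S.exists_abs_eval_le φ
    obtain ⟨B', hB'⟩ := S'.exists_abs_eval_le φ
    refine le_antisymm (ciSup_le fun w => le_of_forall_pos_le_add fun ε hε => ?_)
      (ciSup_le fun z => ?_)
    · obtain ⟨z, hz⟩ := htest φ x y w ε hε
      rw [snoc_comp, ih] at hz
      have := le_ciSup (bddAbove_range_of_abs_le fun z => hB x (Fin.snoc y z)) z
      change _ ≤ (⨆ z, S.eval x φ (Fin.snoc y z)) + ε
      linarith [(abs_sub_le_iff.1 hz).2]
    · rw [← ih, ← snoc_comp]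
      exact le_ciSup (bddAbove_range_of_abs_le fun w => hB' (f ∘ x) (Fin.snoc (f ∘ y) w)) (f z)
  | inf φ ih =>
    obtain ⟨B, hB⟩ := S.exists_abs_eval_le φ
    obtain ⟨B', hB'⟩ := S'.exists_abs_eval_le φ
    refine le_antisymm (le_ciInf fun z => ?_)
      (le_ciInf fun w => le_of_forall_pos_le_add fun ε hε => ?_)
    · rw [← ih, ← snoc_comp]
      exact ciInf_le (bddBelow_range_of_abs_le fun w => hB' (f ∘ x) (Fin.snoc (f ∘ y) w)) (f z)
    · obtain ⟨z, hz⟩ := htest φ x y w ε hε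
      rw [snoc_comp, ih] at hz
      have := ciInf_le (bddBelow_range_of_abs_le fun z => hB x (Fin.snoc y z)) z
      change (⨅ z, S.eval x φ (Fin.snoc y z)) ≤ _
      linarith [(abs_sub_le_iff.1 hz).1]

/-- Every witness is itself an image, so the test holds with no error. This gives invariance of
formulas under automorphisms. -/
theorem IsEmbedding.eval_of_surjective {f : M → N} (hf : IsEmbedding S S' f)
    (hs : Function.Surjective f) {α : Type w} {n : ℕ}
    (φ : Formula L α n) (x : α → M) (y : Fin n → M) :
    S'.eval (f ∘ x) φ (f ∘ y) = S.eval x φ y := by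
  refine hf.eval_of_test (fun φ x y w ε hε => ?_) φ x y
  obtain ⟨z, rfl⟩ := hs w
  exact ⟨z, by simpa using hε.le⟩

/-- An embedding is elementary if any point of the larger structure can be moved approximately
into the smaller one by an automorphism that approximately fixes given finitely many points of the
smaller one. -/
theorem IsEmbedding.eval_of_automorphisms {f : M → N} (hf : IsEmbedding S S' f)
    (h : ∀ (s : Set M) (w : N) (ε : ℝ), s.Finite → 0 < ε → ∃ (T : N → N) (z : M),
      IsEmbedding S' S' T ∧ Function.Surjective T ∧ (∀ m ∈ s, Dist.dist (f m) (T (f m)) < ε) ∧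
        Dist.dist (f z) (T w) < ε)
    {α : Type w} [Finite α] {n : ℕ} (φ : Formula L α n) (x : α → M) (y : Fin n → M) :
    S'.eval (f ∘ x) φ (f ∘ y) = S.eval x φ y := by
  refine hf.eval_of_test (fun φ x y w ε hε => ?_) φ x y
  obtain ⟨δ, hδ, hφ⟩ := S'.eval_uniformContinuous φ hε
  obtain ⟨T, z, hT, hTs, hs, hz⟩ := h (Set.range x ∪ Set.range y) w δ
    ((Set.finite_range x).union (Set.finite_range y)) hδ
  refine ⟨z, ?_⟩
  -- Applying `T` to all arguments leaves the value at `w` unchanged; afterwards corresponding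
  -- arguments differ by less than `δ`.
  rw [← hT.eval_of_surjective hTs φ (f ∘ x) (Fin.snoc (f ∘ y) w), ← snoc_comp]
  refine hφ _ _ _ _ (fun a => hs _ (Or.inl ⟨a, rfl⟩)) fun i => ?_
  refine Fin.lastCases ?_ (fun i => ?_) i
  · simpa using hz
  · simpa using hs _ (Or.inr ⟨i, rfl⟩)

end MetricStructure

/-! ### Linear isometries as embeddings of metric structures -/

section

variable {K : Type*} [RCLike K] {X Y : Type*} [NormedAddCommGroup X] [NormedSpace K X]
  [NormedAddCommGroup Y] [NormedSpace K Y]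

/-- The rescaling factor depends only on the norm, so linear isometries commute with it and hence
with the symbols `σ_a`. -/
theorem map_toBall (T : X →ₗᵢ[K] Y) (x : X) : T (toBall K x) = toBall K (T x) := by
  unfold toBall
  rw [T.norm_map]
  split_ifs
  · rfl
  · rw [map_smul]

/-- The restriction of a linear isometry to the unit balls. -/
def ballMap (T : X →ₗᵢ[K] Y) (x : UnitBall X) : UnitBall Y :=
  ⟨T x, by rw [mem_closedBall_zero_iff, T.norm_map]; exact mem_closedBall_zero_iff.1 x.2⟩

theorem dist_ballMap (T : X →ₗᵢ[K] Y) (x : UnitBall X) (y : UnitBall Y) :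
    dist (ballMap T x) y = ‖T x - y‖ := by
  rw [Subtype.dist_eq, dist_eq_norm, ballMap]

theorem isEmbedding_ballMap [CompleteSpace X] [CompleteSpace Y] (T : X →ₗᵢ[K] Y) :
    (banachStructure K X).IsEmbedding (banachStructure K Y) (ballMap T) where
  isometry := Isometry.of_dist_eq fun x y => by
    rw [dist_ballMap, Subtype.dist_eq, dist_eq_norm, ballMap, ← map_sub, T.norm_map]
  map_func := by
    intro n F x
    cases F with
    | zero => exact Subtype.ext (map_zero T)
    | lin a =>
      refine Subtype.ext ?_
      change T (toBall K (∑ i, a i • (x i : X))) = toBall K (∑ i, a i • T (x i : X))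
      rw [map_toBall, map_sum]
      simp only [map_smul]
  map_pred := by
    intro n P x
    cases P with
    | norm a =>
      change ‖∑ i, a i • T (x i : X)‖ = ‖∑ i, a i • (x i : X)‖
      rw [← T.norm_map, map_sum]
      simp only [map_smul]

theorem ballMap_surjective {T : X →ₗᵢ[K] Y} (hT : Function.Surjective T) :
    Function.Surjective (ballMap T) := by
  rintro ⟨y, hy⟩
  obtain ⟨x, rfl⟩ := hT y
  exact ⟨⟨x, by simpa using hy⟩, rfl⟩

end

/-! ### The spaces `ℓ_p(I)` -/

section

variable {K : Type*} [RCLike K] {p : ENNReal} {I J : Type*}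

theorem hasSum_extend {M : Type*} [AddCommMonoid M] [TopologicalSpace M] {f : J → M} {a : M}
    (e : J ↪ I) (h : HasSum f a) : HasSum (Function.extend e f 0) a := by
  rw [← e.injective.hasSum_iff]
  · rwa [Function.extend_comp e.injective]
  · rintro i hi
    rw [Function.extend_apply' _ _ _ (by simpa using hi), Pi.zero_apply]

theorem norm_extend_rpow (hp : 0 < p.toReal) (e : J ↪ I) (f : J → K) (i : I) :
    ‖Function.extend e f 0 i‖ ^ p.toReal =
      Function.extend e (fun j => ‖f j‖ ^ p.toReal) 0 i := by
  by_cases h : ∃ j, e j = i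
  · obtain ⟨j, rfl⟩ := h
    rw [e.injective.extend_apply, e.injective.extend_apply]
  · rw [Function.extend_apply' _ _ _ h, Function.extend_apply' _ _ _ h]
    simp [hp.ne']

variable [Fact (1 ≤ p)]

theorem toReal_pos_of_fact (hp : p ≠ ⊤) : 0 < p.toReal :=
  ENNReal.toReal_pos (zero_lt_one.trans_le Fact.out).ne' hp

/-- Extension by zero along an injective map, as a linear isometry of `ℓ_p`-spaces. -/
def extendZero (hp : p ≠ ⊤) (e : J ↪ I) :
    lp (fun _ : J => K) p →ₗᵢ[K] lp (fun _ : I => K) p where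
  toFun f := ⟨Function.extend e f 0, by
    have h0 := toReal_pos_of_fact hp
    refine (memℓp_gen_iff h0).2 ?_
    simp only [norm_extend_rpow h0]
    exact (hasSum_extend e (lp.hasSum_norm h0 f)).summable⟩
  map_add' f g := by
    ext i
    change Function.extend e (⇑(f + g)) 0 i = Function.extend e f 0 i + Function.extend e g 0 i
    by_cases h : ∃ j, e j = i
    · obtain ⟨j, rfl⟩ := h
      simp only [e.injective.extend_apply]
      rfl
    · simp only [Function.extend_apply' _ _ _ h, Pi.zero_apply, add_zero]
  map_smul' c f := by
    ext i
    change Function.extend e (⇑(c • f)) 0 i = c • Function.extend e f 0 i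
    by_cases h : ∃ j, e j = i
    · obtain ⟨j, rfl⟩ := h
      simp [e.injective.extend_apply]
    · simp [Function.extend_apply' _ _ _ h]
  norm_map' f := by
    have h0 := toReal_pos_of_fact hp
    refine (Real.rpow_left_inj (norm_nonneg _) (norm_nonneg _) h0.ne').1 ?_
    refine (lp.hasSum_norm h0 _).unique ?_
    change HasSum (fun i => ‖Function.extend e f 0 i‖ ^ p.toReal) _
    simp only [norm_extend_rpow h0]
    exact hasSum_extend e (lp.hasSum_norm h0 f)

theorem extendZero_apply (hp : p ≠ ⊤) (e : J ↪ I) (f : lp (fun _ : J => K) p) (j : J) :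
    extendZero hp e f (e j) = f j :=
  e.injective.extend_apply _ _ _

theorem extendZero_apply_of_notMem (hp : p ≠ ⊤) (e : J ↪ I) (f : lp (fun _ : J => K) p) {i : I}
    (h : ∀ j, e j ≠ i) : extendZero hp e f i = 0 :=
  Function.extend_apply' _ _ _ (by simpa using h)

open Classical in
theorem extendZero_single (hp : p ≠ ⊤) (e : J ↪ I) (j : J) (c : K) :
    extendZero hp e (lp.single p j c) = lp.single p (e j) c := by
  ext i
  by_cases h : ∃ j, e j = i
  · obtain ⟨j', rfl⟩ := h
    rw [extendZero_apply, lp.single_apply, lp.single_apply, Pi.single_apply, Pi.single_apply]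
    simp
  · push Not at h
    rw [extendZero_apply_of_notMem hp e _ h, lp.single_apply_ne _ _ _ (h j).symm]

theorem extendZero_surjective (hp : p ≠ ⊤) (π : Equiv.Perm I) :
    Function.Surjective (extendZero (K := K) hp π.toEmbedding) := by
  intro f
  refine ⟨extendZero hp π.symm.toEmbedding f, ?_⟩
  ext i
  obtain ⟨j, rfl⟩ := π.surjective i
  have h1 := extendZero_apply hp π.toEmbedding (extendZero hp π.symm.toEmbedding f) j
  have h2 := extendZero_apply hp π.symm.toEmbedding f (π j)
  simp only [Equiv.coe_toEmbedding, Equiv.symm_apply_apply] at h1 h2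
  rw [h1, h2]

end

/-- Given an embedding `e` of an infinite set and finite sets `F` and `G`, there is a permutation
that fixes the image of `F` and maps `G` into the range of `e`. -/
theorem exists_perm_fix_mapsTo {I J : Type*} [Infinite J] (e : J ↪ I) (F : Finset J)
    (G : Finset I) :
    ∃ π : Equiv.Perm I, (∀ j ∈ F, π (e j) = e j) ∧ ∀ i ∈ G, ∃ k, π i = e k := by
  classical
  induction G using Finset.induction_on with
  | empty => exact ⟨1, by simp, by simp⟩
  | insert g G _ ih =>
    obtain ⟨π, hF, hG⟩ := ih
    by_cases hg : ∃ k, π g = e k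
    · exact ⟨π, hF, by simpa [hg] using hG⟩
    -- A fresh `k`, with `e k` outside `e F` and `π G`: swapping `π g` with `e k` then disturbs
    -- nothing already arranged.
    obtain ⟨k, hk⟩ := Infinite.exists_notMem_finset
      (F ∪ (G.image π).preimage e e.injective.injOn)
    simp only [Finset.mem_union, Finset.mem_preimage, not_or] at hk
    refine ⟨Equiv.swap (π g) (e k) * π, fun j hj => ?_, fun i hi => ?_⟩
    · rw [Equiv.Perm.mul_apply, hF j hj]
      refine Equiv.swap_apply_of_ne_of_ne (fun h => hg ⟨j, h.symm⟩) fun h => hk.1 ?_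
      rwa [← e.injective h]
    · rw [Equiv.Perm.mul_apply]
      rcases Finset.mem_insert.1 hi with rfl | hi
      · exact ⟨k, Equiv.swap_apply_left _ _⟩
      · obtain ⟨k', hk'⟩ := hG i hi
        refine ⟨k', ?_⟩
        rw [hk']
        refine Equiv.swap_apply_of_ne_of_ne (fun h => hg ⟨k', h.symm⟩) fun h => hk.2 ?_
        rw [← h, ← hk']
        exact Finset.mem_image_of_mem _ hi

/-! ### Elementarity of the embeddings between `ℓ_p`-spaces -/

section

variable {K : Type*} [RCLike K] {p : ENNReal} [Fact (1 ≤ p)] {I J : Type*}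

open Classical in
theorem exists_norm_sub_sum_single_lt (hp : p ≠ ⊤) (f : lp (fun _ : I => K) p) {ε : ℝ}
    (hε : 0 < ε) :
    ∃ F : Finset I, ∀ G, F ⊆ G → ‖f - ∑ i ∈ G, lp.single p i (f i)‖ < ε := by
  obtain ⟨F, hF⟩ := Filter.eventually_atTop.1
    (Metric.tendsto_nhds.1 (lp.hasSum_single hp f) ε hε)
  refine ⟨F, fun G hG => ?_⟩
  rw [← dist_eq_norm, dist_comm]
  exact hF G hG

open Classical in
theorem norm_sum_single_le (hp : p ≠ ⊤) (f : lp (fun _ : I => K) p) (F : Finset I) :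
    ‖∑ i ∈ F, lp.single p i (f i)‖ ≤ ‖f‖ := by
  have h0 := toReal_pos_of_fact hp
  rw [← Real.rpow_le_rpow_iff (norm_nonneg _) (norm_nonneg _) h0, lp.norm_sum_single h0]
  exact lp.sum_rpow_le_norm_rpow h0 f F

/-- The embedding of `ℓ_p(J)` into `ℓ_p(I)`, for an infinite subset `J` of `I`, is elementary. -/
theorem eval_ballMap_extendZero [Infinite J] (hp : p ≠ ⊤) (e : J ↪ I) {α : Type w} [Finite α]
    {n : ℕ} (φ : Formula (banachSignature K) α n) (x : α → UnitBall (lp (fun _ : J => K) p))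
    (y : Fin n → UnitBall (lp (fun _ : J => K) p)) :
    (banachStructure K (lp (fun _ : I => K) p)).eval (ballMap (extendZero hp e) ∘ x) φ
      (ballMap (extendZero hp e) ∘ y) =
    (banachStructure K (lp (fun _ : J => K) p)).eval x φ y := by
  classical
  refine (isEmbedding_ballMap (extendZero hp e)).eval_of_automorphisms
    (fun s w ε hs hε => ?_) φ x y
  -- Accuracy `ε / 2`, because the tail of `m` enters twice below: once as it is and once moved by
  -- `T`.
  choose F hF using fun m : UnitBall (lp (fun _ : J => K) p) =>
    exists_norm_sub_sum_single_lt hp (m : lp (fun _ : J => K) p) (half_pos hε)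
  obtain ⟨G, hG⟩ := exists_norm_sub_sum_single_lt hp (w : lp (fun _ : I => K) p) hε
  obtain ⟨π, hπF, hπG⟩ := exists_perm_fix_mapsTo e (hs.toFinset.biUnion F) G
  choose! k hk using hπG
  set T := extendZero (K := K) hp π.toEmbedding with hT
  have hTw : T (∑ i ∈ G, lp.single p i ((w : lp (fun _ : I => K) p) i)) =
      extendZero hp e (∑ i ∈ G, lp.single p (k i) ((w : lp (fun _ : I => K) p) i)) := by
    rw [map_sum, map_sum]
    refine Finset.sum_congr rfl fun i hi => ?_
    rw [hT, extendZero_single, extendZero_single, ← hk i hi]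
    rfl
  -- Truncation does not increase the norm, so the witness lies in the unit ball, the universe of
  -- the structure.
  have hz : ‖∑ i ∈ G, lp.single (E := fun _ : J => K) p (k i)
      ((w : lp (fun _ : I => K) p) i)‖ ≤ 1 := by
    rw [← (extendZero hp e).norm_map, ← hTw, T.norm_map]
    exact (norm_sum_single_le hp _ G).trans (mem_closedBall_zero_iff.1 w.2)
  refine ⟨ballMap T, ⟨_, mem_closedBall_zero_iff.2 hz⟩, isEmbedding_ballMap T,
    ballMap_surjective (extendZero_surjective hp π), fun m hm => ?_, ?_⟩
  · have hfix : T (extendZero hp e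
        (∑ j ∈ F m, lp.single p j ((m : lp (fun _ : J => K) p) j))) = extendZero hp e
        (∑ j ∈ F m, lp.single p j ((m : lp (fun _ : J => K) p) j)) := by
      rw [map_sum, map_sum]
      refine Finset.sum_congr rfl fun j hj => ?_
      rw [hT, extendZero_single, extendZero_single, Equiv.coe_toEmbedding,
        hπF j (Finset.mem_biUnion.2 ⟨m, hs.mem_toFinset.2 hm, hj⟩)]
    rw [dist_ballMap]
    obtain ⟨m, hm1⟩ := m
    change ‖extendZero hp e m - T (extendZero hp e m)‖ < ε
    dsimp only at hfix
    set m₀ := ∑ j ∈ F ⟨m, hm1⟩, lp.single p j (m j) with hm₀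
    have h1 := hF ⟨m, hm1⟩ _ subset_rfl
    rw [← hm₀] at h1
    have h2 : extendZero hp e m - T (extendZero hp e m) =
        extendZero hp e (m - m₀) - T (extendZero hp e (m - m₀)) := by
      rw [map_sub, map_sub, hfix]
      abel
    have h3 := norm_sub_le (extendZero hp e (m - m₀)) (T (extendZero hp e (m - m₀)))
    rw [T.norm_map, (extendZero hp e).norm_map] at h3
    rw [h2]
    linarith
  · rw [dist_ballMap]
    change ‖extendZero hp e _ - T w‖ < ε
    rw [← hTw, ← map_sub, T.norm_map, norm_sub_rev]
    exact hG G subset_rfl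

theorem models_theory_lp [Infinite J] (hp : p ≠ ⊤) (e : J ↪ I) :
    (banachStructure K (lp (fun _ : I => K) p)).Models
      (banachStructure K (lp (fun _ : J => K) p)).theory := by
  intro φ hφ
  have h := eval_ballMap_extendZero hp e φ Empty.elim Fin.elim0
  rw [MetricStructure.value, ← hφ, MetricStructure.value, ← h]
  congr 1 <;> exact Subsingleton.elim _ _

end

/-- Distinct unit coordinate vectors are at distance at least `1`, as one coordinate shows; points
of a dense set within `1/2` of them are therefore distinct. -/
theorem le_densityCharacter_lp {K : Type} [RCLike K] {p : ENNReal} [Fact (1 ≤ p)] (hp : p ≠ ⊤)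
    {I : Type u} :
    Cardinal.mk I ≤ densityCharacter (UnitBall (lp (fun _ : I => K) p)) := by
  classical
  have h0 := toReal_pos_of_fact hp
  refine le_csInf ⟨_, Set.univ, dense_univ, rfl⟩ ?_
  rintro _ ⟨s, hs, rfl⟩
  have hp' : 0 < p := zero_lt_one.trans_le Fact.out
  let b : I → UnitBall (lp (fun _ : I => K) p) := fun i =>
    ⟨lp.single p i 1, mem_closedBall_zero_iff.2 (by rw [lp.norm_single hp', norm_one])⟩
  choose g hgs hg using fun i => hs.exists_dist_lt (b i) (half_pos one_pos)
  refine Cardinal.mk_le_of_injective (f := fun i => (⟨g i, hgs i⟩ : s)) fun i j hij => ?_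
  by_contra hne
  have hgij : g i = g j := congrArg Subtype.val hij
  have h1 := dist_triangle_right (b i) (b j) (g i)
  have h2 : dist (b i) (b j) < 1 := by
    have := hg j
    rw [← hgij] at this
    linarith [hg i]
  rw [Subtype.dist_eq, dist_eq_norm] at h2
  have h3 := lp.norm_apply_le_norm hp'.ne' (lp.single p i 1 - lp.single p j 1 : lp (fun _ : I => K) p) i
  change ‖(lp.single p i 1 - lp.single p j 1 : lp (fun _ : I => K) p)‖ < 1 at h2
  rw [lp.coeFn_sub, Pi.sub_apply, lp.single_apply_self, lp.single_apply_ne _ _ _ hne, sub_zero,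
    norm_one] at h3
  linarith

/-! ### Infinite-dimensional subspaces of `ℓ_p(I)` -/

section

variable {K : Type*} [RCLike K] {p : ENNReal} {I : Type*}

/-- The norm in `ℓ_p` of the sum of two vectors with disjoint supports. -/
theorem norm_add_rpow_of_disjoint (hp : 0 < p.toReal) {f g : lp (fun _ : I => K) p}
    (h : ∀ i, f i = 0 ∨ g i = 0) :
    ‖f + g‖ ^ p.toReal = ‖f‖ ^ p.toReal + ‖g‖ ^ p.toReal := by
  refine (lp.hasSum_norm hp (f + g)).unique ?_
  convert (lp.hasSum_norm hp f).add (lp.hasSum_norm hp g) using 2 with i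
  rcases h i with h | h <;> simp [h, hp.ne']

variable [Fact (1 ≤ p)]

/-- The norm of the sum of a fixed vector and of unit vectors that vanish on larger and larger
finite sets. -/
theorem tendsto_norm_add (hp : p ≠ ⊤) (f : lp (fun _ : I => K) p)
    (g : Finset I → lp (fun _ : I => K) p) (hg : ∀ F, ‖g F‖ = 1) (hgF : ∀ F, ∀ i ∈ F, g F i = 0) :
    Filter.Tendsto (fun F => ‖f + g F‖) Filter.atTop
      (nhds ((‖f‖ ^ p.toReal + 1) ^ p.toReal⁻¹)) := by
  classical
  have h0 : 0 < p.toReal := toReal_pos_of_fact hp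
  have hf : Filter.Tendsto (fun F : Finset I => ∑ i ∈ F, lp.single p i (f i)) Filter.atTop
    (nhds f) := lp.hasSum_single hp f
  -- For the truncation of `f` to `F` the supports are disjoint, so the formula is exact; the error
  -- of truncation is bounded independently of `g`.
  have h1 : ∀ F, ‖∑ i ∈ F, lp.single p i (f i) + g F‖ =
      (‖∑ i ∈ F, lp.single p i (f i)‖ ^ p.toReal + 1) ^ p.toReal⁻¹ := by
    intro F
    rw [Real.eq_rpow_inv (norm_nonneg _) (by positivity) h0.ne', norm_add_rpow_of_disjoint h0,
      hg, Real.one_rpow]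
    intro i
    by_cases hi : i ∈ F
    · exact Or.inr (hgF F i hi)
    · left
      simp only [lp.coeFn_single, lp.coeFn_sum, Finset.sum_apply, Finset.sum_pi_single, hi,
        if_false]
  have h2 : Filter.Tendsto (fun F => ‖∑ i ∈ F, lp.single p i (f i) + g F‖) Filter.atTop
      (nhds ((‖f‖ ^ p.toReal + 1) ^ p.toReal⁻¹)) := by
    simp only [h1]
    exact ((hf.norm.rpow_const (Or.inr h0.le)).add_const 1).rpow_const
      (Or.inr (inv_nonneg.2 h0.le))
  have h3 : Filter.Tendsto (fun F => ‖f + g F‖ - ‖∑ i ∈ F, lp.single p i (f i) + g F‖)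
      Filter.atTop (nhds 0) := by
    refine squeeze_zero_norm (fun F => ?_) (by simpa using (hf.sub_const f).norm)
    rw [Real.norm_eq_abs]
    refine (abs_norm_sub_norm_le _ _).trans_eq ?_
    rw [add_sub_add_right_eq_sub, norm_sub_rev]
  simpa using h3.add h2

/-- In an infinite-dimensional subspace there are unit vectors in the kernel of any given finite
family of coordinates and of any linear map of finite rank. -/
theorem exists_unit_vanishing {V : Submodule ℝ (lp (fun _ : I => K) p)}
    (hV : ¬ FiniteDimensional ℝ V) {W : Type*} [AddCommGroup W] [Module ℝ W]
    [FiniteDimensional ℝ W] (g : V →ₗ[ℝ] W) (F : Finset I) :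
    ∃ x : V, ‖x‖ = 1 ∧ (∀ i ∈ F, (x : lp (fun _ : I => K) p) i = 0) ∧ g x = 0 := by
  let c : V →ₗ[ℝ] (F → K) := LinearMap.pi fun i =>
    { toFun := fun x => (x : lp (fun _ : I => K) p) i
      map_add' := fun x y => rfl
      map_smul' := fun r x => rfl }
  -- `K` is finite-dimensional over `ℝ`, so all the constraints together form a real linear map of
  -- finite rank.
  have hnot : ¬ Function.Injective (c.prod g) := fun h =>
    hV (FiniteDimensional.of_injective (c.prod g) h)
  rw [← LinearMap.ker_eq_bot, ← ne_eq, Submodule.ne_bot_iff] at hnot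
  obtain ⟨x, hx, hx0⟩ := hnot
  have hx' : ‖x‖ ≠ 0 := norm_ne_zero_iff.2 hx0
  have hcx : c.prod g (‖x‖⁻¹ • x) = 0 := by rw [map_smul, LinearMap.mem_ker.1 hx, smul_zero]
  refine ⟨‖x‖⁻¹ • x, ?_, fun i hi => ?_, congrArg Prod.snd hcx⟩
  · rw [norm_smul, norm_inv, norm_norm, inv_mul_cancel₀ hx']
  · exact congrFun (congrArg Prod.fst hcx) ⟨i, hi⟩

/-- The comparison of growth rates that settles both `p > 2` (`a = 2/p`, `b = 1`) and `p < 2` (`a =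
1`, `b = 2/p`). -/
theorem not_forall_natCast_rpow_le {a b : ℝ} (hab : a < b) (D : ℝ) :
    ¬ ∀ k : ℕ, (k : ℝ) ^ b ≤ D * (k : ℝ) ^ a := by
  intro h
  have ht := (tendsto_rpow_atTop (sub_pos.2 hab)).comp tendsto_natCast_atTop_atTop
  obtain ⟨k, hk, hk1⟩ := ((ht.eventually_gt_atTop D).and (Filter.eventually_ge_atTop 1)).exists
  have hk0 : (0 : ℝ) < k := by exact_mod_cast hk1
  have h1 := h k
  have h2 : (k : ℝ) ^ b = (k : ℝ) ^ (b - a) * (k : ℝ) ^ a := by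
    rw [← Real.rpow_add hk0, sub_add_cancel]
  rw [h2] at h1
  exact absurd (le_of_mul_le_mul_right h1 (Real.rpow_pos_of_pos hk0 a)) (not_le.2 hk)

/-- An infinite-dimensional subspace of `ℓ_p(I)`, `p ≠ 2`, admits no isomorphism into an inner
product space. -/
theorem not_bounds_of_not_finiteDimensional (hp : p ≠ ⊤) (hp2 : p ≠ 2)
    {V : Submodule ℝ (lp (fun _ : I => K) p)} (hV : ¬ FiniteDimensional ℝ V)
    {H : Type*} [NormedAddCommGroup H] [InnerProductSpace ℝ H] (T : V →ₗ[ℝ] H) {c C : ℝ}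
    (hc : 0 < c) (hT1 : ∀ x, c * ‖x‖ ≤ ‖T x‖) (hT2 : ∀ x, ‖T x‖ ≤ C * ‖x‖) : False := by
  have h0 : 0 < p.toReal := toReal_pos_of_fact hp
  -- Each hump adds `1` to `‖x‖^p` up to an error `1/2`, hence the total error `k/2`.
  have key : ∀ k : ℕ, ∃ x : V, |‖x‖ ^ p.toReal - k| ≤ k / 2 ∧ c ^ 2 * k ≤ ‖T x‖ ^ 2 ∧
      ‖T x‖ ^ 2 ≤ C ^ 2 * k := by
    intro k
    induction k with
    | zero => exact ⟨0, by simp [h0.ne']⟩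
    | succ k ih =>
      obtain ⟨x, hx, hx1, hx2⟩ := ih
      -- The extra functional makes `T (y F)` orthogonal to `T x`, so Pythagoras applies on the
      -- Hilbert side.
      choose y hy hyF hyT using
        fun F => exists_unit_vanishing hV ((innerₗ H (T x)).comp T) F
      have ht := (tendsto_norm_add hp (x : lp (fun _ : I => K) p) (fun F => y F) hy hyF).rpow_const
        (p := p.toReal) (Or.inr h0.le)
      rw [Real.rpow_inv_rpow (by positivity) h0.ne'] at ht
      obtain ⟨F, hF⟩ := (Metric.tendsto_nhds.1 ht (1 / 2) (by norm_num)).exists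
      have hxy : ‖T (x + y F)‖ ^ 2 = ‖T x‖ ^ 2 + ‖T (y F)‖ ^ 2 := by
        have h : inner ℝ (T x) (T (y F)) = 0 := hyT F
        rw [map_add, norm_add_sq_real, h]
        ring
      have h1 := hT1 (y F)
      have h2 := hT2 (y F)
      rw [hy, mul_one] at h1 h2
      refine ⟨x + y F, ?_, ?_, ?_⟩
      · rw [Real.dist_eq] at hF
        have h3 := abs_add_le (‖x‖ ^ p.toReal - k) (‖x + y F‖ ^ p.toReal - (‖x‖ ^ p.toReal + 1))
        have h4 : ‖x + y F‖ ^ p.toReal - ((k + 1 : ℕ) : ℝ) = (‖x‖ ^ p.toReal - k) +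
            (‖x + y F‖ ^ p.toReal - (‖x‖ ^ p.toReal + 1)) := by
          push_cast
          ring
        have h5 : |‖x + y F‖ ^ p.toReal - (‖x‖ ^ p.toReal + 1)| < 1 / 2 := hF
        rw [h4]
        push_cast
        linarith
      · rw [hxy]
        push_cast
        linarith [pow_le_pow_left₀ hc.le h1 2]
      · rw [hxy]
        push_cast
        linarith [pow_le_pow_left₀ (norm_nonneg _) h2 2]
  have hsq : ∀ x : V, (‖x‖ ^ p.toReal) ^ (2 / p.toReal) = ‖x‖ ^ 2 := by
    intro x
    rw [← Real.rpow_mul (norm_nonneg _), mul_div_cancel₀ _ h0.ne', Real.rpow_two]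
  have hq : (2 / p.toReal : ℝ) ≠ 1 := by
    intro h
    rw [div_eq_one_iff_eq h0.ne'] at h
    exact hp2 ((ENNReal.toReal_eq_toReal_iff' hp ENNReal.ofNat_ne_top).1 (by simpa using h.symm))
  have hq0 : 0 ≤ 2 / p.toReal := by positivity
  rcases lt_or_gt_of_ne hq with hq | hq
  · refine not_forall_natCast_rpow_le hq (C ^ 2 * (3 / 2) ^ (2 / p.toReal) / c ^ 2) fun k => ?_
    obtain ⟨x, hx, hx1, -⟩ := key k
    have h1 : ‖x‖ ^ 2 ≤ (3 / 2) ^ (2 / p.toReal) * (k : ℝ) ^ (2 / p.toReal) := by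
      rw [← hsq, ← Real.mul_rpow (by norm_num) (Nat.cast_nonneg _)]
      exact Real.rpow_le_rpow (by positivity) (by linarith [(abs_le.1 hx).2]) hq0
    have h2 := pow_le_pow_left₀ (norm_nonneg _) (hT2 x) 2
    rw [Real.rpow_one, div_mul_eq_mul_div, le_div_iff₀ (by positivity)]
    nlinarith [sq_nonneg C]
  · refine not_forall_natCast_rpow_le hq (C ^ 2 * 2 ^ (2 / p.toReal) / c ^ 2) fun k => ?_
    obtain ⟨x, hx, -, hx2⟩ := key k
    have h1 : (k : ℝ) ^ (2 / p.toReal) ≤ 2 ^ (2 / p.toReal) * ‖x‖ ^ 2 := by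
      rw [← hsq, ← Real.mul_rpow (by norm_num) (by positivity)]
      exact Real.rpow_le_rpow (by positivity) (by linarith [(abs_le.1 hx).1]) hq0
    have h2 := pow_le_pow_left₀ (by positivity) (hT1 x) 2
    have h3 : (0 : ℝ) ≤ 2 ^ (2 / p.toReal) := by positivity
    rw [Real.rpow_one, div_mul_eq_mul_div, le_div_iff₀ (by positivity)]
    calc (k : ℝ) ^ (2 / p.toReal) * c ^ 2 ≤ 2 ^ (2 / p.toReal) * ‖x‖ ^ 2 * c ^ 2 := by gcongr
      _ = 2 ^ (2 / p.toReal) * (c * ‖x‖) ^ 2 := by ring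
      _ ≤ 2 ^ (2 / p.toReal) * (C ^ 2 * k) := by gcongr; exact h2.trans hx2
      _ = _ := by ring

/-- A subspace of `ℓ_p(I)`, `p ≠ 2`, with Ficken's symmetry property is finite-dimensional. -/
theorem finiteDimensional_of_norm_sub_smul_symm (hp : p ≠ ⊤) (hp2 : p ≠ 2)
    {V : Submodule ℝ (lp (fun _ : I => K) p)}
    (h : ∀ x ∈ V, ∀ y ∈ V, ‖x‖ = ‖y‖ → ∀ t : ℝ, ‖x - t • y‖ = ‖t • x - y‖) :
    FiniteDimensional ℝ V := by
  by_contra hV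
  have h0 : 0 < p.toReal := toReal_pos_of_fact hp
  obtain ⟨x, hx, -⟩ := exists_unit_vanishing hV (0 : V →ₗ[ℝ] ℝ) ∅
  choose y hy hyF _ using exists_unit_vanishing hV (0 : V →ₗ[ℝ] ℝ)
  set ρ : ℝ := 2 ^ p.toReal⁻¹ with hρ
  have hρ0 : 0 < ρ := by positivity
  have hr : Filter.Tendsto (fun F => ‖x + y F‖) Filter.atTop (nhds ρ) := by
    have := tendsto_norm_add hp (x : lp (fun _ : I => K) p) (fun F => y F) hy hyF
    rw [show ‖(x : lp (fun _ : I => K) p)‖ = 1 from hx, Real.one_rpow, one_add_one_eq_two] at this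
    exact this
  have h1 : Filter.Tendsto (fun F => ‖(ρ ^ 2 - 1) • x - y F‖) Filter.atTop
      (nhds ((|ρ ^ 2 - 1| ^ p.toReal + 1) ^ p.toReal⁻¹)) := by
    have := tendsto_norm_add hp (((ρ ^ 2 - 1) • x : V) : lp (fun _ : I => K) p)
      (fun F => ((-y F : V) : lp (fun _ : I => K) p)) (fun F => (norm_neg (y F)).trans (hy F))
      (fun F i hi => neg_eq_zero.2 (hyF F i hi))
    rw [show ‖(((ρ ^ 2 - 1) • x : V) : lp (fun _ : I => K) p)‖ = |ρ ^ 2 - 1| by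
      rw [Submodule.norm_coe, norm_smul, hx, mul_one, Real.norm_eq_abs]] at this
    simp only [sub_eq_add_neg] at this ⊢
    exact this
  -- The coefficient of `x` varies with `F`, whereas the limit formula needs a fixed vector;
  -- replacing it by its limit costs an error tending to zero.
  have h2 : Filter.Tendsto (fun F => ‖(‖x + y F‖ ^ 2 - 1) • x - y F‖ -
      ‖(ρ ^ 2 - 1) • x - y F‖) Filter.atTop (nhds 0) := by
    have h3 : Filter.Tendsto (fun F => ‖((‖x + y F‖ ^ 2 - 1) - (ρ ^ 2 - 1)) • x‖) Filter.atTop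
        (nhds 0) := by
      have := ((((hr.pow 2).sub_const 1).sub_const (ρ ^ 2 - 1)).smul_const x).norm
      simpa using this
    refine squeeze_zero_norm (fun F => ?_) h3
    rw [Real.norm_eq_abs]
    refine (abs_norm_sub_norm_le _ _).trans_eq ?_
    rw [sub_smul _ (ρ ^ 2 - 1)]
    congr 1
    abel
  -- With `r = ‖x + y‖`, apply the symmetry to the unit vectors `x` and `(x + y)/r` with `t = 1/r`.
  -- The right side collapses to `‖y‖/r = 1/r`, and multiplying by `r²` gives the claim.
  have h3 : ∀ᶠ F in Filter.atTop, ‖(‖x + y F‖ ^ 2 - 1) • x - y F‖ = ‖x + y F‖ := by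
    filter_upwards [hr.eventually_const_lt hρ0] with F hF
    set r := ‖x + y F‖ with hrF
    have h4 := h x x.2 (r⁻¹ • (x + y F) : V) (SetLike.coe_mem _) (by
      change ‖x‖ = ‖(r⁻¹ • (x + y F) : V)‖
      rw [norm_smul, norm_inv, Real.norm_eq_abs, abs_of_pos hF, ← hrF, hx,
        inv_mul_cancel₀ hF.ne']) r⁻¹
    have h5 : ‖x - r⁻¹ • r⁻¹ • (x + y F)‖ = ‖r⁻¹ • x - r⁻¹ • (x + y F)‖ := h4
    have h6 : r⁻¹ • x - r⁻¹ • (x + y F) = -(r⁻¹ • y F) := by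
      rw [smul_add]
      abel
    have h7 : (r ^ 2 - 1) • x - y F = r ^ 2 • (x - r⁻¹ • r⁻¹ • (x + y F)) := by
      rw [smul_sub, smul_smul, smul_smul, show r ^ 2 * r⁻¹ * r⁻¹ = 1 by field_simp, one_smul,
        sub_smul, one_smul]
      abel
    rw [h7, norm_smul, h5, h6, norm_neg, norm_smul, hy, norm_inv, norm_pow, Real.norm_eq_abs,
      abs_of_pos hF]
    field_simp
  have h4 : (|ρ ^ 2 - 1| ^ p.toReal + 1) ^ p.toReal⁻¹ = ρ := by
    refine tendsto_nhds_unique ?_ hr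
    refine Filter.Tendsto.congr' h3 ?_
    simpa using h2.add h1
  rw [hρ, Real.rpow_left_inj (by positivity) (by norm_num) (inv_pos.2 h0).ne', ← hρ] at h4
  have h5 : |ρ ^ 2 - 1| = 1 := by
    rw [← Real.rpow_left_inj (abs_nonneg _) zero_le_one h0.ne', Real.one_rpow]
    linarith
  -- The other sign would give `ρ = 0`.
  have h6 : ρ ^ 2 = 2 := by
    rcases abs_eq zero_le_one |>.1 h5 with h | h
    · linarith
    · nlinarith
  have h7 : p.toReal⁻¹ * 2 = 1 := by
    rw [hρ, ← Real.rpow_two, ← Real.rpow_mul zero_le_two] at h6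
    exact (Real.rpow_right_inj two_pos (by norm_num)).1 (h6.trans (Real.rpow_one 2).symm)
  refine hp2 ((ENNReal.toReal_eq_toReal_iff' hp ENNReal.ofNat_ne_top).1 ?_)
  rw [ENNReal.toReal_ofNat]
  field_simp at h7
  linarith

end

/-! ### Indiscernible subspaces -/

/-- Allowing every sufficiently large `n` lets two vectors be expanded over a common range. -/
theorem exists_range_of_mem_span {X : Type*} [AddCommGroup X] [Module ℝ X] {x : ℕ → X}
    {u : X}
    (hu : u ∈ Submodule.span ℝ (Set.range x)) :
    ∃ (m : ℕ) (a : ℕ → ℝ), ∀ n ≥ m, u = ∑ i ∈ Finset.range n, a i • x i := by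
  obtain ⟨c, rfl⟩ := Finsupp.mem_span_range_iff_exists_finsupp.1 hu
  obtain ⟨m, hm⟩ := c.support.exists_nat_subset_range
  exact ⟨m, c, fun n hn => Finsupp.sum_of_support_subset c
    (hm.trans (Finset.range_subset_range.2 hn)) _ (by simp)⟩

section

variable {K : Type*} [RCLike K] {X : Type*} [NormedAddCommGroup X] [NormedSpace K X]
  [CompleteSpace X] [NormedSpace ℝ X] [IsScalarTower ℝ K X]

/-- Indiscernible subspaces have Ficken's symmetry property. -/
theorem IsIndiscernibleSubspace.norm_sub_smul_symm {A : Set (UnitBall X)} {V : Submodule ℝ X}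
    (hV : IsIndiscernibleSubspace K A V) {x y : X} (hx : x ∈ V) (hy : y ∈ V) (hxy : ‖x‖ = ‖y‖)
    (t : ℝ) : ‖x - t • y‖ = ‖t • x - y‖ := by
  -- Types concern only the unit ball, so `x` and `y` are scaled into it; the `1 +` keeps the factor
  -- finite and nonzero when `x = 0`.
  have hs : 0 < (1 + ‖x‖)⁻¹ := by positivity
  set s : ℝ := (1 + ‖x‖)⁻¹ with hsx
  have hsle : ∀ z : X, ‖z‖ = ‖x‖ → s • z ∈ UnitBall X := by
    intro z hz
    rw [mem_closedBall_zero_iff, norm_smul, Real.norm_eq_abs, abs_of_pos hs, hz, hsx,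
      inv_mul_le_one₀ (by positivity)]
    linarith
  let x' : UnitBall X := ⟨s • x, hsle x rfl⟩
  let y' : UnitBall X := ⟨s • y, hsle y hxy.symm⟩
  have hmem : ∀ i : Fin 2, ((![x', y'] i : UnitBall X) : X) ∈ V ∧
      ((![y', x'] i : UnitBall X) : X) ∈ V := by
    have hx' := V.smul_mem s hx
    have hy' := V.smul_mem s hy
    intro i
    fin_cases i
    exacts [⟨hx', hy'⟩, ⟨hy', hx'⟩]
  have hnorm : ‖(x' : X)‖ = ‖(y' : X)‖ := by
    change ‖s • x‖ = ‖s • y‖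
    rw [norm_smul, norm_smul, hxy]
  have hcong : Congruent (fun i => (![x', y'] i : X)) (fun i => (![y', x'] i : X)) := by
    refine ⟨fun i j => ?_, fun i => ?_⟩
    · fin_cases i <;> fin_cases j <;> simp [norm_sub_rev]
    · fin_cases i <;> simp [hnorm]
  -- The swapped pairs share their type, which is tested on the predicate `‖z₀ - t z₁‖`.
  have h := (hV 2 ![x', y'] ![y', x'] (fun i => (hmem i).1) fun i => (hmem i).2).2 hcong
    (.pred (BanachPred.norm ![1, -(t : K)] : BanachPred K 2) fun i => .var (Sum.inl (Sum.inr i)))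
  change ‖∑ i, (![1, -(t : K)] i) • ((![x', y'] i : UnitBall X) : X)‖ =
    ‖∑ i, (![1, -(t : K)] i) • ((![y', x'] i : UnitBall X) : X)‖ at h
  simp only [Fin.sum_univ_two, Matrix.cons_val_zero, Matrix.cons_val_one, one_smul, neg_smul,
    ← RCLike.real_smul_eq_coe_smul, ← sub_eq_add_neg, x', y'] at h
  rw [smul_comm t s, smul_comm t s, ← smul_sub, ← smul_sub, norm_smul, norm_smul] at h
  rw [mul_left_cancel₀ (norm_ne_zero_iff.2 hs.ne') h, norm_sub_rev]

theorem norm_sum_of_realizes {x : ℕ → UnitBall X}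
    (hx : (banachStructure K X).Realizes x (indiscernibleType K)) (m : ℕ) (a : ℕ → ℝ) :
    ‖∑ i ∈ Finset.range m, a i • (x i : X)‖ = Real.sqrt (∑ i ∈ Finset.range m, a i ^ 2) := by
  have h := hx _ (Or.inl ⟨m, fun i => a i, rfl⟩)
  change |‖∑ i : Fin m, (a i : K) • (x i : X)‖ - Real.sqrt (∑ i : Fin m, a i ^ 2)| = 0 at h
  rw [abs_eq_zero, sub_eq_zero] at h
  rw [Finset.sum_range, Finset.sum_range, ← h]
  simp only [RCLike.real_smul_eq_coe_smul (K := K)]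

/-- The span of a realization of the type of an infinite-dimensional indiscernible subspace has
Ficken's symmetry property. -/
theorem norm_sub_smul_symm_of_realizes {x : ℕ → UnitBall X}
    (hx : (banachStructure K X).Realizes x (indiscernibleType K)) {u v : X}
    (hu : u ∈ Submodule.span ℝ (Set.range fun i => (x i : X)))
    (hv : v ∈ Submodule.span ℝ (Set.range fun i => (x i : X))) (huv : ‖u‖ = ‖v‖) (t : ℝ) :
    ‖u - t • v‖ = ‖t • u - v‖ := by
  obtain ⟨m, a, ha⟩ := exists_range_of_mem_span hu
  obtain ⟨n, b, hb⟩ := exists_range_of_mem_span hv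
  rw [ha _ (le_max_left m n), hb _ (le_max_right m n)] at huv ⊢
  rw [norm_sum_of_realizes hx, norm_sum_of_realizes hx,
    Real.sqrt_inj (Finset.sum_nonneg fun _ _ => sq_nonneg _)
      (Finset.sum_nonneg fun _ _ => sq_nonneg _)] at huv
  rw [Finset.smul_sum, Finset.smul_sum, ← Finset.sum_sub_distrib, ← Finset.sum_sub_distrib]
  simp only [smul_smul, ← sub_smul]
  rw [norm_sum_of_realizes hx, norm_sum_of_realizes hx]
  congr 1
  -- The correction term sums to `(1 - t²)(‖u‖² - ‖v‖²) = 0`.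
  have h1 : ∀ i, (a i - t * b i) ^ 2 =
      (t * a i - b i) ^ 2 + (1 - t ^ 2) * (a i ^ 2 - b i ^ 2) := fun i => by ring
  simp only [h1]
  rw [Finset.sum_add_distrib, ← Finset.mul_sum, Finset.sum_sub_distrib, huv, sub_self, mul_zero,
    add_zero]

theorem not_finiteDimensional_span_of_realizes {x : ℕ → UnitBall X}
    (hx : (banachStructure K X).Realizes x (indiscernibleType K)) :
    ¬ FiniteDimensional ℝ (Submodule.span ℝ (Set.range fun i => (x i : X))) := by
  intro hfin
  have hli : LinearIndependent ℝ fun i => (x i : X) := by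
    refine linearIndependent_iff.2 fun c hc => Finsupp.ext fun j => ?_
    -- Inserting `j` ensures that the range reaches `j` even when `c j = 0`.
    obtain ⟨m, hm⟩ := (insert j c.support).exists_nat_subset_range
    rw [Finsupp.linearCombination_apply, Finsupp.sum_of_support_subset c
      ((Finset.subset_insert _ _).trans hm) _ (by simp)] at hc
    have h := norm_sum_of_realizes hx m c
    rw [hc, norm_zero, eq_comm, Real.sqrt_eq_zero (Finset.sum_nonneg fun _ _ => sq_nonneg _),
      Finset.sum_eq_zero_iff_of_nonneg fun _ _ => sq_nonneg _] at h
    simpa using h j (hm (Finset.mem_insert_self _ _))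
  exact not_finite_iff_infinite.2 (inferInstanceAs (Infinite ℕ)) (linearIndependent_span hli).finite

end

end ContinuousLogic

end

/-! ### The theorem -/

open ContinuousLogic in
theorem mainTheorem7 (K : Type) [RCLike K] (p : ENNReal) [Fact (1 ≤ p)]
    (hp_top : p ≠ ⊤) (hp_two : p ≠ 2) (κ : Cardinal.{u}) :
    ∃ (X : Type u) (_ : NormedAddCommGroup X) (_ : NormedSpace K X) (_ : CompleteSpace X)
      (_ : NormedSpace ℝ X) (_ : IsScalarTower ℝ K X),
      (banachStructure K X).Models (banachStructure K (lp (fun _ : ℕ => K) p)).theory ∧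
      κ ≤ densityCharacter (UnitBall X) ∧
      (∀ V : Submodule ℝ X, ¬ FiniteDimensional ℝ V →
        ∀ (H : Type v) [NormedAddCommGroup H] [InnerProductSpace ℝ H] [CompleteSpace H],
          IsEmpty (V ≃L[ℝ] H)) ∧
      (∀ (A : Set (UnitBall X)) (V : Submodule ℝ X),
        IsIndiscernibleSubspace K A V → FiniteDimensional ℝ V) ∧
      (banachStructure K X).Omits (indiscernibleType K) := by
  -- The summand `ℕ` provides the elementary copy of `ℓ_p(ℕ)` whatever `κ` is, even finite.
  let I : Type u := κ.out ⊕ ULift.{u} ℕ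
  let e : ℕ ↪ I := ⟨fun n => Sum.inr ⟨n⟩, fun m n h => ULift.up_inj.1 (Sum.inr.inj h)⟩
  have hκ : κ ≤ Cardinal.mk I := by
    rw [Cardinal.mk_sum, Cardinal.mk_out]
    simp
  refine ⟨lp (fun _ : I => K) p, inferInstance, inferInstance, inferInstance, inferInstance,
    inferInstance, models_theory_lp hp_top e, hκ.trans (le_densityCharacter_lp hp_top), ?_, ?_, ?_⟩
  · intro V hV H _ _ _
    refine ⟨fun T => ?_⟩
    refine not_bounds_of_not_finiteDimensional hp_top hp_two hV T.toLinearMap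
      -- The `+ 1` gives a positive constant without proving that the inverse has nonzero norm.
      (c := (‖(T.symm : H →L[ℝ] V)‖ + 1)⁻¹) (C := ‖(T : V →L[ℝ] H)‖) (by positivity)
      (fun x => ?_) fun x => (T : V →L[ℝ] H).le_opNorm x
    have h := (T.symm : H →L[ℝ] V).le_opNorm (T x)
    rw [ContinuousLinearEquiv.coe_coe, T.symm_apply_apply] at h
    rw [inv_mul_le_iff₀ (by positivity)]
    exact h.trans (mul_le_mul_of_nonneg_right (by linarith) (norm_nonneg _))
  · intro A V hV
    exact finiteDimensional_of_norm_sub_smul_symm hp_top hp_two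
      fun x hx y hy hxy t => hV.norm_sub_smul_symm hx hy hxy t
  · intro x hx
    exact not_finiteDimensional_span_of_realizes hx
      (finiteDimensional_of_norm_sub_smul_symm hp_top hp_two
        fun u hu v hv huv t => norm_sub_smul_symm_of_realizes hx hu hv huv t)
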